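/- Conventions. A small category $\Lambda$ is identified with its set of morphisms, $\Lambda^0$ is its set of objects (identity morphisms), $s,r$ are source and range, and $\alpha\beta$ is defined when $s(\alpha)=r(\beta)$. $\Lambda$ is left cancellative (an LCSC) if $\alpha\beta=\alpha\gamma$ implies $\beta=\gamma$; it is finitely aligned if each $\alpha\Lambda\cap\beta\Lambda$ is a finite union of sets $\gamma\Lambda$. Write $\alpha\le\beta$ if $\beta\in\alpha\Lambda$, and $[\beta]=\{\alpha:\alpha\le\beta\}$. $\mathsf{FE}(\alpha)$ is the collection of finite $F\subseteq r(\alpha)\Lambda$ such that every $\gamma\in\alpha\Lambda$ satisfies $\beta\Lambda\cap\gamma\Lambda\ne\emptyset$ for some $\beta\in F$. *Category systems.* Let $\Gamma$ be a submonoid of a group with $\Gamma\cap\Gamma^{-1}=\{1\}$. A length function is a map $\mathbf d:\Lambda\to\Gamma$ with $\mathbf d(\alpha\beta)=\mathbf d(\alpha)\mathbf d(\beta)$ whenever $s(\alpha)=r(\beta)$. $\mathrm{PIso}(\Lambda,\mathbf d)$ is the groupoid of all bijections $f:v\Lambda\to w\Lambda$ ($v,w\in\Lambda^0$) with $f(\alpha\Lambda)=f(\alpha)\Lambda$,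 $f(v)=w$ and $\mathbf d(f(\alpha))=\mathbf d(\alpha)$. An action of a discrete groupoid $\mathcal G$ on $\Lambda$ is a groupoid homomorphism $\mathcal G\to\mathrm{PIso}(\Lambda,\mathbf d)$ that is bijective on units; $\mathcal G^{(0)}$ is thereby identified with $\Lambda^0$, and $g\cdot\alpha$ is defined when $s(g)=r(\alpha)$. A category system $(\Lambda,\mathbf d,\mathcal G,\varphi)$ is an action with a map $\varphi:\{(g,\alpha):s(g)=r(\alpha)\}\to\mathcal G$ such that, whenever the expressions make sense, $\varphi(gh,\alpha)=\varphi(g,h\cdot\alpha)\varphi(h,\alpha)$, $s(\varphi(g,\alpha))=s(\alpha)$, $r(\varphi(g,\alpha))=s(g\cdot\alpha)$, $\varphi(g,s(g))=g$, $\varphi(r(\alpha),\alpha)=s(\alpha)$, $\varphi(g,\alpha\beta)=\varphi(\varphi(g,\alpha),\beta)$ and $g\cdot(\alpha\beta)=(g\cdot\alpha)(\varphi(g,\alpha)\cdot\beta)$. Its Zappa–Szép product $\Lambda\Join^\varphi\mathcal G$ is the category of pairs $(\alpha,g)\in\Lambda\times\mathcal G$ with $s(\alpha)=r(g)$, with $r(\alpha,g)=r(\alpha)$,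 $s(\alpha,g)=s(g)$ and $(\alpha,g)(\beta,h)=(\alpha(g\cdot\beta),\varphi(g,\beta)h)$. It is left cancellative, and finitely aligned if $\Lambda$ is. *Tight groupoid.* Let $\Lambda$ be a finitely aligned LCSC. $\Lambda^*$ is the set of nonempty $F\subseteq\Lambda$ that are hereditary ($\alpha\le\beta\in F$ implies $\alpha\in F$) and directed (any $\alpha,\beta\in F$ have an upper bound in $F$). $\Lambda^{**}$ is the set of its maximal elements under inclusion. $\Lambda_{tight}$ is the set of $C\in\Lambda^*$ such that for every $\alpha\in C$ and every finite $K\subseteq\Lambda$ with $C\cap K=\emptyset$ there is $D\in\Lambda^{**}$ with $\alpha\in D$ and $D\cap K=\emptyset$; it carries the topology inherited from $\{0,1\}^\Lambda$. $\mathcal S_\Lambda$ is the semigroup of partial bijections of $\Lambda$ generated by all $\tau^\alpha:s(\alpha)\Lambda\to\alpha\Lambda$, $\beta\mapsto\alpha\beta$, and their inverses $\sigma^\alpha$. For $t\in\mathcal S_\Lambda$ and $F\in\Lambda_{tight}$ with $F\cap\operatorname{dom}(t)\ne\emptyset$ put $t\cdot F=\bigcup_{\gamma\in F\cap\operatorname{dom}(t)}[t(\gamma)]\in\Lambda_{tight}$.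 $\mathcal G_{tight}(\Lambda)$ is the groupoid with unit space $\Lambda_{tight}$ whose elements are the germs $[t,F]$ of such pairs, where $[t,F]=[t',F]$ iff $te=t'e$ for some idempotent $e\in\mathcal S_\Lambda$ with $F\cap\operatorname{dom}(e)\ne\emptyset$. The germ $[t,F]$ has source $F$ and range $t\cdot F$, and $[t,t'\cdot F][t',F]=[tt',F]$. The topology is generated by the sets $\Theta(t,U)=\{[t,F]:F\in U,\ F\cap\operatorname{dom}(t)\neq\emptyset\}$ with $t\in\mathcal S_\Lambda$ and $U\subseteq\Lambda_{tight}$ open. A topological groupoid is minimal if the only open invariant subsets of its unit space are $\emptyset$ and the whole unit space. **Proposition.** Let $\Lambda$ be a finitely aligned LCSC with length function $\mathbf d:\Lambda\to\Gamma$, let $\mathcal G$ be a discrete groupoid acting on $\Lambda$, and let $(\Lambda,\mathbf d,\mathcal G,\varphi)$ be a category system with Zappa–Szép product $\Lambda\Join^\varphi\mathcal G$. Suppose that $\mathcal G_{tight}(\Lambda\Join^\varphi\mathcal G)$ is Hausdorff or that $\Lambda_{tight}=\Lambda^{**}$. Then the following are equivalent: 1. $\mathcal G_{tight}(\Lambda\Join^\varphi\mathcal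 G)$ is minimal. 2. For all $(\alpha,a),(\beta,b)\in\Lambda\Join^\varphi\mathcal G$ there is $F\in\mathsf{FE}(\alpha,a)$ such that $s(\beta,b)(\Lambda\Join^\varphi\mathcal G)s(\gamma,g)\ne\emptyset$ for each $(\gamma,g)\in F$. 3. For all $\alpha,\beta\in\Lambda$ there is $F\in\mathsf{FE}(\alpha)$ such that for each $\gamma\in F$ there is $g\in\mathcal G$ with $s(g)=s(\gamma)$ and $s(\beta)\Lambda(g\cdot s(\gamma))\ne\emptyset$. -/

import Mathlib

open CategoryTheory

namespace LCSC

universe u v w z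

variable {V : Type u}

/-! ### Small categories

A small category is a category structure `C` on a type `V` of objects.  A morphism `α` has source
`s(α)` and range `r(α)`, and a product `αβ` (defined when `s(α) = r(β)`) is the composite
"`β` first, then `α`", that is `C.comp β α`.
-/

/-- The set `xΛ` of the morphisms with range `x`. -/
abbrev Into (C : Category.{v} V) (x : V) : Type max u v := Σ a : V, C.Hom a x

/-- The set of all morphisms of a category. -/
@[ext]
structure Mor (C : Category.{v} V) : Type max u v where
  /-- the source `s(α)` -/
  src : V
  /-- the range `r(α)` -/
  tgt : V
  hom : C.Hom src tgt

/-- The identity morphism at `x`, as an element of `xΛ`. -/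
abbrev Into.unit (C : Category.{v} V) (x : V) : Into C x := ⟨x, C.id x⟩

/-- An element of `xΛ` as a morphism. -/
abbrev Into.toMor {C : Category.{v} V} {x : V} (α : Into C x) : Mor C := ⟨α.1, x, α.2⟩

/-- The product `αβ ∈ xΛ` for `α ∈ xΛ` and `β ∈ s(α)Λ`. -/
abbrev Into.mul {C : Category.{v} V} {x : V} (α : Into C x) (β : Into C α.1) : Into C x :=
  ⟨β.1, C.comp β.2 α.2⟩

/-- The product `αβ` for `β ∈ s(α)Λ`. -/
abbrev Mor.mul {C : Category.{v} V} (α : Mor C) (β : Into C α.src) : Mor C :=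
  ⟨β.1, α.tgt, C.comp β.2 α.hom⟩

/-- `αβ = αγ` implies `β = γ`. -/
def LeftCancellative (C : Category.{v} V) : Prop :=
  ∀ (a x y : V) (α : C.Hom x y) (β γ : C.Hom a x), C.comp β α = C.comp γ α → β = γ

/-- The right ideal `αΛ`. -/
def ideal {C : Category.{v} V} (α : Mor C) : Set (Mor C) := Set.range α.mul

/-- `α ≤ β`: the morphism `β` extends `α`, that is, `β ∈ αΛ`. -/
def Initial {C : Category.{v} V} (α β : Mor C) : Prop := β ∈ ideal α

/-- `α ⋒ β`: the morphisms `α` and `β` have a common extension. -/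
def Meets {C : Category.{v} V} (α β : Mor C) : Prop := (ideal α ∩ ideal β).Nonempty

def FinitelyAligned (C : Category.{v} V) : Prop :=
  ∀ α β : Mor C, ∃ Γ : Finset (Mor C), ideal α ∩ ideal β = ⋃ γ ∈ Γ, ideal γ

/-- `FE(α)`: the finite subsets of `r(α)Λ` that are exhaustive with respect to `α`. -/
def FE {C : Category.{v} V} (α : Mor C) : Set (Finset (Mor C)) :=
  {F | (∀ β ∈ F, β.tgt = α.tgt) ∧ ∀ γ ∈ ideal α, ∃ β ∈ F, Meets β γ}

theorem Initial.refl {C : Category.{v} V} (α : Mor C) : Initial α α :=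
  ⟨⟨α.src, C.id _⟩, by cases α; simp only [Mor.mul]; rw [C.id_comp]⟩

theorem Initial.trans {C : Category.{v} V} {α β γ : Mor C} (h : Initial α β)
    (h' : Initial β γ) : Initial α γ := by
  obtain ⟨δ, rfl⟩ := h
  obtain ⟨ε, rfl⟩ := h'
  exact ⟨⟨ε.1, C.comp ε.2 δ.2⟩, by simp only [Mor.mul]; rw [C.assoc]⟩

/-! ### Length functions, partial isomorphisms, groupoid actions -/

/-- A length function with values in a submonoid `Γ` of a group. -/
structure LengthFunction (C : Category.{v} V) {Q : Type z} [Group Q] (Γ : Submonoid Q) where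
  toFun : Mor C → Γ
  map_mul : ∀ (α : Mor C) (β : Into C α.src), toFun (α.mul β) = toFun α * toFun β.toMor

variable {Q : Type z} [Group Q] {Γ : Submonoid Q}

/-- The partial isomorphisms `xΛ → yΛ` preserving right ideals, units and length. -/
@[ext]
structure PIso {C : Category.{v} V} (d : LengthFunction C Γ) (x y : V) where
  toEquiv : Into C x ≃ Into C y
  image_ideal : ∀ α : Into C x,
    toEquiv '' (Set.range α.mul) = Set.range (toEquiv α).mul
  map_unit : toEquiv (Into.unit C x) = Into.unit C y
  map_length : ∀ α : Into C x, d.toFun (toEquiv α).toMor = d.toFun α.toMor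

/-- The identity of `xΛ`. -/
def PIso.id {C : Category.{v} V} (d : LengthFunction C Γ) (x : V) : PIso d x x where
  toEquiv := Equiv.refl _
  image_ideal α := by simp
  map_unit := rfl
  map_length _ := rfl

/-- The composite `f ∘ g`. -/
def PIso.comp {C : Category.{v} V} {d : LengthFunction C Γ} {x y t : V} (f : PIso d y t)
    (g : PIso d x y) : PIso d x t where
  toEquiv := g.toEquiv.trans f.toEquiv
  image_ideal α := by
    rw [Equiv.coe_trans, Set.image_comp, g.image_ideal, f.image_ideal]
    rfl
  map_unit := by
    rw [Equiv.trans_apply, g.map_unit, f.map_unit]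
  map_length α := by
    rw [Equiv.trans_apply, f.map_length, g.map_length]

/-- An action of a (discrete) groupoid `𝒢` on the category `C`: a groupoid homomorphism from `𝒢` to
the groupoid of partial isomorphisms.  The homomorphism is bijective on units, and the units of `𝒢`
are identified with those of `C`; that is, both have the same set `V` of objects. -/
structure GroupoidAction {C : Category.{v} V} (d : LengthFunction C Γ) (𝒢 : Groupoid.{w} V) where
  map : ∀ {x y : V}, 𝒢.Hom x y → PIso d x y
  map_id : ∀ x : V, map (𝒢.id x) = PIso.id d x
  map_comp : ∀ {x y t : V} (g : 𝒢.Hom y t) (h : 𝒢.Hom x y),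
    map (𝒢.comp h g) = (map g).comp (map h)

/-- `g · α` for `α ∈ s(g)Λ`. -/
def GroupoidAction.act {C : Category.{v} V} {d : LengthFunction C Γ} {𝒢 : Groupoid.{w} V}
    (A : GroupoidAction d 𝒢) {x y : V} (g : 𝒢.Hom x y) (α : Into C x) : Into C y :=
  (A.map g).toEquiv α

/-- A category system: a groupoid action together with a category cocycle
`φ(g, α)`, where `s(g) = r(α)`.  The type of `cocycle` says that `φ(g, α)` has source `s(α)` and
range `s(g · α)`.  Equations between elements of `𝒢` are equations in `Mor`, so that they include
the equality of sources and ranges. -/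
structure CategorySystem {C : Category.{v} V} (d : LengthFunction C Γ) (𝒢 : Groupoid.{w} V)
    extends GroupoidAction d 𝒢 where
  cocycle : ∀ {x y : V} (g : 𝒢.Hom x y) (α : Into C x),
    𝒢.Hom α.1 (toGroupoidAction.act g α).1
  /-- `φ(gh, α) = φ(g, h · α) φ(h, α)` -/
  cocycle_comp : ∀ {x y t : V} (g : 𝒢.Hom y t) (h : 𝒢.Hom x y) (α : Into C x),
    (⟨_, _, cocycle (𝒢.comp h g) α⟩ : Mor 𝒢.toCategory) =
      ⟨_, _, 𝒢.comp (cocycle h α) (cocycle g (toGroupoidAction.act h α))⟩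
  /-- `φ(g, s(g)) = g` -/
  cocycle_unit : ∀ {x y : V} (g : 𝒢.Hom x y),
    (⟨_, _, cocycle g (Into.unit C x)⟩ : Mor 𝒢.toCategory) = ⟨_, _, g⟩
  /-- `φ(r(α), α) = s(α)` -/
  unit_cocycle : ∀ {x : V} (α : Into C x),
    (⟨_, _, cocycle (𝒢.id x) α⟩ : Mor 𝒢.toCategory) = ⟨_, _, 𝒢.id α.1⟩
  /-- `φ(g, αβ) = φ(φ(g, α), β)` -/
  cocycle_mul : ∀ {x y : V} (g : 𝒢.Hom x y) (α : Into C x) (β : Into C α.1),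
    (⟨_, _, cocycle g (α.mul β)⟩ : Mor 𝒢.toCategory) = ⟨_, _, cocycle (cocycle g α) β⟩
  /-- `g · (αβ) = (g · α)(φ(g, α) · β)` -/
  act_mul : ∀ {x y : V} (g : 𝒢.Hom x y) (α : Into C x) (β : Into C α.1),
    toGroupoidAction.act g (α.mul β) =
      (toGroupoidAction.act g α).mul (toGroupoidAction.act (cocycle g α) β)

/-! ### Zappa-Szép products -/

section ZappaSzep

variable {C : Category.{v} V} {d : LengthFunction C Γ} {𝒢 : Groupoid.{w} V}

theorem GroupoidAction.act_id (A : GroupoidAction d 𝒢) {x : V} (α : Into C x) :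
    A.act (𝒢.id x) α = α := by
  unfold GroupoidAction.act
  rw [A.map_id]
  rfl

theorem GroupoidAction.act_comp (A : GroupoidAction d 𝒢) {x y t : V} (g : 𝒢.Hom y t)
    (h : 𝒢.Hom x y) (α : Into C x) : A.act (𝒢.comp h g) α = A.act g (A.act h α) := by
  unfold GroupoidAction.act
  rw [A.map_comp]
  rfl

theorem GroupoidAction.act_unit (A : GroupoidAction d 𝒢) {x y : V} (g : 𝒢.Hom x y) :
    A.act g (Into.unit C x) = Into.unit C y := (A.map g).map_unit

/-- The pairs `(α, g)` with `s(α) = r(g)`, `r(α) = y` and `s(g) = x`: the morphisms from `x` to `y`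
of the Zappa-Szép product. -/
@[ext]
structure ZSHom (C : Category.{v} V) (𝒢 : Groupoid.{w} V) (x y : V) : Type max u v w where
  left : Into C y
  right : 𝒢.Hom x left.1

theorem ZSHom.ext' {x y : V} {p q : ZSHom C 𝒢 x y} (h₁ : p.left = q.left)
    (h₂ : (⟨_, _, p.right⟩ : Mor 𝒢.toCategory) = ⟨_, _, q.right⟩) : p = q := by
  obtain ⟨l, r⟩ := p
  obtain ⟨l', r'⟩ := q
  obtain rfl : l = l' := h₁
  simpa using h₂

/-- `(α, g)(β, h) = (α (g · β), φ(g, β) h)`. -/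
def CategorySystem.zsMul (S : CategorySystem d 𝒢) {x y t : V} (p : ZSHom C 𝒢 y t)
    (q : ZSHom C 𝒢 x y) : ZSHom C 𝒢 x t where
  left := p.left.mul (S.act p.right q.left)
  right := 𝒢.comp q.right (S.cocycle p.right q.left)

theorem mor_comp_congr {a b c c' : V} (f : 𝒢.Hom a b) {g : 𝒢.Hom b c} {g' : 𝒢.Hom b c'}
    (h : (⟨_, _, g⟩ : Mor 𝒢.toCategory) = ⟨_, _, g'⟩) :
    (⟨_, _, 𝒢.comp f g⟩ : Mor 𝒢.toCategory) = ⟨_, _, 𝒢.comp f g'⟩ := by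
  simp only [Mor.mk.injEq, true_and] at h
  obtain ⟨rfl, h⟩ := h
  rw [eq_of_heq h]

/-- The Zappa-Szép product, a category with the same objects. -/
@[reducible]
def CategorySystem.zappaSzep (S : CategorySystem d 𝒢) : Category.{max u v w} V where
  Hom := ZSHom C 𝒢
  id x := ⟨Into.unit C x, 𝒢.id x⟩
  comp q p := S.zsMul p q
  id_comp p := by
    refine ZSHom.ext' ?_ ?_
    · change p.left.mul (S.act p.right (Into.unit C _)) = p.left
      rw [S.act_unit]
      simp only [Into.mul]
      rw [C.id_comp]
    · change (⟨_, _, 𝒢.comp (𝒢.id _) (S.cocycle p.right (Into.unit C _))⟩ :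
        Mor 𝒢.toCategory) = _
      rw [𝒢.id_comp]
      exact S.cocycle_unit p.right
  comp_id p := by
    refine ZSHom.ext' ?_ ?_
    · change (Into.unit C _).mul (S.act (𝒢.id _) p.left) = p.left
      rw [S.act_id]
      simp only [Into.mul]
      rw [C.comp_id]
    · change (⟨_, _, 𝒢.comp p.right (S.cocycle (𝒢.id _) p.left)⟩ : Mor 𝒢.toCategory) = _
      refine (mor_comp_congr _ (S.unit_cocycle p.left)).trans ?_
      rw [𝒢.comp_id]
  assoc r q p := by
    refine ZSHom.ext' ?_ ?_
    · change p.left.mul (S.act p.right (q.left.mul (S.act q.right r.left))) =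
        (p.left.mul (S.act p.right q.left)).mul
          (S.act (𝒢.comp q.right (S.cocycle p.right q.left)) r.left)
      rw [S.act_mul, S.act_comp]
      simp only [Into.mul]
      rw [C.assoc]
    · change (⟨_, _, 𝒢.comp (𝒢.comp r.right (S.cocycle q.right r.left))
          (S.cocycle p.right (q.left.mul (S.act q.right r.left)))⟩ : Mor 𝒢.toCategory) =
        ⟨_, _, 𝒢.comp r.right
          (S.cocycle (𝒢.comp q.right (S.cocycle p.right q.left)) r.left)⟩
      refine (mor_comp_congr _ (S.cocycle_mul p.right q.left _)).trans ?_
      rw [𝒢.assoc]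
      exact (mor_comp_congr _ (S.cocycle_comp _ _ _)).symm

theorem Into.mul_injective (hC : LeftCancellative C) {x : V} (α : Into C x) :
    Function.Injective α.mul := by
  rintro ⟨a, β⟩ ⟨b, γ⟩ h
  simp only [Into.mul, Sigma.mk.injEq] at h
  obtain ⟨rfl, h⟩ := h
  rw [hC _ _ _ _ _ _ (eq_of_heq h)]

theorem CategorySystem.zappaSzep_leftCancellative (S : CategorySystem d 𝒢)
    (hC : LeftCancellative C) : LeftCancellative S.zappaSzep := by
  intro a x y p q q' h
  change S.zsMul p q = S.zsMul p q' at h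
  obtain ⟨β, k⟩ := q
  obtain ⟨β', k'⟩ := q'
  have h₁ : p.left.mul (S.act p.right β) = p.left.mul (S.act p.right β') :=
    congrArg ZSHom.left h
  obtain rfl : β = β' :=
    (S.map p.right).toEquiv.injective (Into.mul_injective hC _ h₁)
  simp only [CategorySystem.zsMul, ZSHom.mk.injEq, heq_eq_eq, true_and] at h
  have h₂ : ∀ {b c : V} (f g : 𝒢.Hom a b) (e : 𝒢.Hom b c),
      𝒢.comp f e = 𝒢.comp g e → f = g := by
    intro b c f g e hfg
    have := congrArg (fun t => 𝒢.comp t (𝒢.inv e)) hfg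
    simpa only [𝒢.assoc, 𝒢.comp_inv, 𝒢.comp_id] using this
  obtain rfl : k = k' := h₂ _ _ _ h
  rfl

end ZappaSzep

/-! ### The inverse semigroup of a left cancellative small category

The symmetric inverse semigroup on a set `X` is the type `X ≃. X` of partial bijections. -/

section Semigroup

/-- The partial bijection with a given graph. -/
noncomputable def pequivOfGraph {X : Type*} (R : X → X → Prop)
    (h₁ : ∀ a b b', R a b → R a b' → b = b') (h₂ : ∀ a a' b, R a b → R a' b → a = a') :
    X ≃. X := by
  classical exact
  { toFun := fun a => if h : ∃ b, R a b then some h.choose else none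
    invFun := fun b => if h : ∃ a, R a b then some h.choose else none
    inv := by
      intro a b
      constructor
      · intro h
        split_ifs at h with hb
        · obtain rfl : hb.choose = a := by simpa using h
          have ha : ∃ b, R hb.choose b := ⟨b, hb.choose_spec⟩
          rw [dif_pos ha]
          exact congrArg some (h₁ _ _ _ ha.choose_spec hb.choose_spec)
      · intro h
        split_ifs at h with ha
        · obtain rfl : ha.choose = b := by simpa using h
          have hb : ∃ a, R a ha.choose := ⟨a, ha.choose_spec⟩
          rw [dif_pos hb]
          exact congrArg some (h₂ _ _ _ hb.choose_spec ha.choose_spec) }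

theorem mem_pequivOfGraph {X : Type*} {R : X → X → Prop} {h₁ h₂} {a b : X} :
    b ∈ pequivOfGraph R h₁ h₂ a ↔ R a b := by
  classical
  change b ∈ (if h : ∃ b, R a b then some h.choose else none) ↔ _
  split_ifs with h
  · constructor
    · intro hb
      obtain rfl : h.choose = b := by simpa using hb
      exact h.choose_spec
    · intro hb
      exact congrArg some (h₁ _ _ _ h.choose_spec hb)
  · constructor
    · intro hb
      simp at hb
    · intro hb
      exact absurd ⟨b, hb⟩ h

variable {C : Category.{v} V}

theorem Into.toMor_injective {x : V} {β γ : Into C x} (h : β.toMor = γ.toMor) : β = γ := by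
  obtain ⟨a, β⟩ := β
  obtain ⟨b, γ⟩ := γ
  simpa using h

theorem Mor.mul_injective (hC : LeftCancellative C) (α : Mor C) :
    Function.Injective α.mul := by
  rintro ⟨a, β⟩ ⟨b, γ⟩ h
  simp only [Mor.mul, Mor.mk.injEq, true_and] at h
  obtain ⟨rfl, h⟩ := h
  rw [hC _ _ _ _ _ _ (eq_of_heq h)]

/-- `τ^α : s(α)Λ → αΛ`, `β ↦ αβ`. -/
noncomputable def tau (hC : LeftCancellative C) (α : Mor C) : Mor C ≃. Mor C :=
  pequivOfGraph (fun x y => ∃ β : Into C α.src, x = β.toMor ∧ y = α.mul β)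
    (by
      rintro _ _ _ ⟨β, rfl, rfl⟩ ⟨γ, h, rfl⟩
      rw [Into.toMor_injective h])
    (by
      rintro _ _ _ ⟨β, rfl, rfl⟩ ⟨γ, rfl, h⟩
      rw [Mor.mul_injective hC α h])

/-- `σ^α : αΛ → s(α)Λ`, `αβ ↦ β`. -/
noncomputable def sigma (hC : LeftCancellative C) (α : Mor C) : Mor C ≃. Mor C := (tau hC α).symm

/-- The semigroup generated by the `τ^α` and the `σ^α`.
The product `f g` of partial bijections, first `g` and then `f`, is `g.trans f`. -/
inductive InS (hC : LeftCancellative C) : (Mor C ≃. Mor C) → Prop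
  | tau (α : Mor C) : InS hC (tau hC α)
  | sigma (α : Mor C) : InS hC (sigma hC α)
  | mul {f g : Mor C ≃. Mor C} : InS hC f → InS hC g → InS hC (g.trans f)

/-- The domain of a partial bijection. -/
def dom (f : Mor C ≃. Mor C) : Set (Mor C) := {a | ∃ b, b ∈ f a}

theorem InS.symm {hC : LeftCancellative C} {f : Mor C ≃. Mor C} (hf : InS hC f) :
    InS hC f.symm := by
  induction hf with
  | tau α => exact InS.sigma α
  | sigma α =>
    have h : (LCSC.sigma hC α).symm = LCSC.tau hC α := PEquiv.symm_symm _
    rw [h]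
    exact InS.tau α
  | mul _ _ ih₁ ih₂ =>
    rw [PEquiv.symm_trans_rev]
    exact InS.mul ih₂ ih₁

theorem mem_tau {hC : LeftCancellative C} {α x y : Mor C} :
    y ∈ tau hC α x ↔ ∃ β : Into C α.src, x = β.toMor ∧ y = α.mul β := mem_pequivOfGraph

theorem mem_sigma {hC : LeftCancellative C} {α x y : Mor C} :
    y ∈ sigma hC α x ↔ ∃ β : Into C α.src, y = β.toMor ∧ x = α.mul β := by
  exact (PEquiv.mem_iff_mem (tau hC α)).trans mem_tau

/-- Elements `f` of the semigroup preserve sources, and `f(xε) = f(x)ε`. -/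
theorem InS.equivariant {hC : LeftCancellative C} {f : Mor C ≃. Mor C} (hf : InS hC f) :
    ∀ {x y : Mor C}, y ∈ f x → ∃ h : x.src = y.src, ∀ ε : Into C x.src,
      y.mul (h ▸ ε) ∈ f (x.mul ε) := by
  induction hf with
  | tau α =>
    intro x y hxy
    obtain ⟨β, rfl, rfl⟩ := mem_tau.1 hxy
    refine ⟨rfl, fun ε => mem_tau.2 ⟨β.mul ε, rfl, ?_⟩⟩
    simp only [Mor.mul]
    rw [C.assoc]
  | sigma α =>
    intro x y hxy
    obtain ⟨β, rfl, rfl⟩ := mem_sigma.1 hxy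
    refine ⟨rfl, fun ε => mem_sigma.2 ⟨β.mul ε, rfl, ?_⟩⟩
    simp only [Mor.mul]
    rw [C.assoc]
  | mul _ _ ih₁ ih₂ =>
    intro x y hxy
    obtain ⟨t, ht, hy⟩ := (PEquiv.mem_trans _ _ _ _).1 hxy
    obtain ⟨e, h⟩ := ih₂ ht
    obtain ⟨e', h'⟩ := ih₁ hy
    refine ⟨e.trans e', fun ε => (PEquiv.mem_trans _ _ _ _).2 ⟨_, h ε, ?_⟩⟩
    have hh : ∀ {a b c : V} (e : a = b) (e' : b = c) (ε : Into C a),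
        ((e.trans e') ▸ ε : Into C c) = e' ▸ e ▸ ε := by
      rintro _ _ _ rfl rfl _
      rfl
    rw [hh e e' ε]
    exact h' (e ▸ ε)

theorem InS.initial {hC : LeftCancellative C} {f : Mor C ≃. Mor C} (hf : InS hC f)
    {x y x' : Mor C} (h : y ∈ f x) (hx : Initial x x') : ∃ y', y' ∈ f x' ∧ Initial y y' := by
  obtain ⟨ε, rfl⟩ := hx
  obtain ⟨e, h⟩ := hf.equivariant h
  exact ⟨_, h ε, ⟨_, rfl⟩⟩

/-- Two elements of the semigroup that agree at `x` agree on `xΛ`. -/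
theorem InS.agree {hC : LeftCancellative C} {f g : Mor C ≃. Mor C} (hf : InS hC f)
    (hg : InS hC g) {x y x' : Mor C} (h : y ∈ f x) (h' : y ∈ g x) (hx : Initial x x') :
    f x' = g x' := by
  obtain ⟨ε, rfl⟩ := hx
  obtain ⟨e, h⟩ := hf.equivariant h
  obtain ⟨_, h'⟩ := hg.equivariant h'
  exact (h ε : f _ = some _).trans (h' ε : g _ = some _).symm

end Semigroup

/-! ### Hereditary directed sets, maximal and tight ones -/

section Tight

/-- `Λ^*`: the nonempty, hereditary, directed sets of morphisms. -/
def starSets (C : Category.{v} V) : Set (Set (Mor C)) :=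
  {F | F.Nonempty ∧ (∀ α β, Initial α β → β ∈ F → α ∈ F) ∧
    ∀ α ∈ F, ∀ β ∈ F, ∃ γ ∈ F, Initial α γ ∧ Initial β γ}

/-- `Λ^{**}`: the maximal elements of `Λ^*`. -/
def maximalSets (C : Category.{v} V) : Set (Set (Mor C)) :=
  {F | F ∈ starSets C ∧ ∀ D ∈ starSets C, F ⊆ D → D = F}

/-- `Λ_tight`: the tight elements of `Λ^*`. -/
def tightSets (C : Category.{v} V) : Set (Set (Mor C)) :=
  {F | F ∈ starSets C ∧ ∀ α ∈ F, ∀ K : Finset (Mor C), Disjoint F (K : Set (Mor C)) →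
    ∃ D ∈ maximalSets C, α ∈ D ∧ Disjoint D (K : Set (Mor C))}

/-- The space `Λ_tight`. -/
def TightSpace (C : Category.{v} V) : Type max u v := {F : Set (Mor C) // F ∈ tightSets C}

/-- The topology inherited from the product topology on `{0,1}^Λ`. -/
instance (C : Category.{v} V) : TopologicalSpace (TightSpace C) :=
  TopologicalSpace.generateFrom
    {U | ∃ X Y : Finset (Mor C), U = {F | (X : Set (Mor C)) ⊆ F.1 ∧ Disjoint F.1 (Y : Set (Mor C))}}

variable {C : Category.{v} V}

/-- `f · F`, the union of the sets `[f(γ)]` of initial segments for `γ ∈ F ∩ dom(f)`. -/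
def translate (f : Mor C ≃. Mor C) (F : Set (Mor C)) : Set (Mor C) :=
  {α | ∃ γ ∈ F, ∃ δ ∈ f γ, Initial α δ}

/-! ### The tight groupoid -/

/-- The pairs `(s, F)` with `s` in the semigroup, `F` tight, `F ∩ dom(s) ≠ ∅` and `s · F = F'`.
(If `C` is finitely aligned then `s · F` is tight whenever `F` is, so that every pair `(s, F)`
with `F ∩ dom(s) ≠ ∅` occurs for some `F'`.) -/
structure PreGerm (hC : LeftCancellative C) (F F' : TightSpace C) where
  elt : Mor C ≃. Mor C
  mem : InS hC elt
  meets : (F.1 ∩ dom elt).Nonempty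
  translate_eq : translate elt F.1 = F'.1

/-- `(s, F) ∼ (t, F)`: there is an idempotent `e` of the semigroup with
`F ∩ dom(e) ≠ ∅` and `se = te`. -/
def GermRel (hC : LeftCancellative C) {F F' : TightSpace C} (p q : PreGerm hC F F') : Prop :=
  ∃ e : Mor C ≃. Mor C, InS hC e ∧ e.trans e = e ∧ (F.1 ∩ dom e).Nonempty ∧
    e.trans p.elt = e.trans q.elt

theorem idem_mem {e : Mor C ≃. Mor C} (he : e.trans e = e) {x y : Mor C} (h : y ∈ e x) :
    y = x := by
  have h' : y ∈ e.trans e x := by rw [he]; exact h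
  obtain ⟨t, ht, hy⟩ := (PEquiv.mem_trans _ _ _ _).1 h'
  have : t = y := Option.mem_unique ht h
  subst this
  exact e.inj hy h

theorem mem_sigma_trans_tau {hC : LeftCancellative C} {γ x y : Mor C} :
    y ∈ (sigma hC γ).trans (tau hC γ) x ↔ y = x ∧ Initial γ x := by
  rw [PEquiv.mem_trans]
  constructor
  · rintro ⟨t, h, h'⟩
    obtain ⟨β, rfl, rfl⟩ := mem_sigma.1 h
    obtain ⟨β', h₁, rfl⟩ := mem_tau.1 h'
    rw [Into.toMor_injective h₁]
    exact ⟨rfl, ⟨_, rfl⟩⟩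
  · rintro ⟨rfl, ⟨β, rfl⟩⟩
    exact ⟨β.toMor, mem_sigma.2 ⟨β, rfl, rfl⟩, mem_tau.2 ⟨β, rfl, rfl⟩⟩

theorem germRel_iff {hC : LeftCancellative C} {F F' : TightSpace C} {p q : PreGerm hC F F'} :
    GermRel hC p q ↔ ∃ γ ∈ F.1, ∃ δ, δ ∈ p.elt γ ∧ δ ∈ q.elt γ := by
  constructor
  · rintro ⟨e, he, hee, ⟨γ, hγ, x, hx⟩, h⟩
    obtain rfl := idem_mem hee hx
    obtain ⟨ζ, hζ, δ₀, hδ₀⟩ := p.meets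
    obtain ⟨η, hη, h₁, h₂⟩ := F.2.1.2.2 x hγ ζ hζ
    obtain ⟨δ, hδ, -⟩ := p.mem.initial hδ₀ h₂
    obtain ⟨η', hη', -⟩ := he.initial hx h₁
    obtain rfl := idem_mem hee hη'
    refine ⟨η', hη, δ, hδ, ?_⟩
    have h₃ : δ ∈ e.trans q.elt η' := by
      rw [← h]
      exact (PEquiv.mem_trans _ _ _ _).2 ⟨η', hη', hδ⟩
    obtain ⟨t, ht, ht'⟩ := (PEquiv.mem_trans _ _ _ _).1 h₃
    rwa [idem_mem hee ht] at ht'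
  · rintro ⟨γ, hγ, δ, h₁, h₂⟩
    refine ⟨(sigma hC γ).trans (tau hC γ), InS.mul (.tau _) (.sigma _), ?_,
      ⟨γ, hγ, γ, mem_sigma_trans_tau.2 ⟨rfl, Initial.refl _⟩⟩, ?_⟩
    · ext x y
      change y ∈ ((sigma hC γ).trans (tau hC γ)).trans ((sigma hC γ).trans (tau hC γ)) x ↔
        y ∈ (sigma hC γ).trans (tau hC γ) x
      rw [PEquiv.mem_trans]
      simp only [mem_sigma_trans_tau]
      constructor
      · rintro ⟨t, ⟨rfl, _⟩, h⟩
        exact h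
      · rintro ⟨rfl, h⟩
        exact ⟨y, ⟨rfl, h⟩, rfl, h⟩
    · ext x y
      change y ∈ ((sigma hC γ).trans (tau hC γ)).trans p.elt x ↔
        y ∈ ((sigma hC γ).trans (tau hC γ)).trans q.elt x
      rw [PEquiv.mem_trans, PEquiv.mem_trans]
      simp only [mem_sigma_trans_tau]
      constructor
      · rintro ⟨t, ⟨rfl, h⟩, hy⟩
        exact ⟨t, ⟨rfl, h⟩, by rwa [← p.mem.agree q.mem h₁ h₂ h]⟩
      · rintro ⟨t, ⟨rfl, h⟩, hy⟩
        exact ⟨t, ⟨rfl, h⟩, by rwa [p.mem.agree q.mem h₁ h₂ h]⟩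

/-- The germs with source `F` and range `F'`. -/
def germSetoid (hC : LeftCancellative C) (F F' : TightSpace C) : Setoid (PreGerm hC F F') where
  r := GermRel hC
  iseqv :=
    { refl := fun p => by
        obtain ⟨γ, hγ, δ, hδ⟩ := p.meets
        exact germRel_iff.2 ⟨γ, hγ, δ, hδ, hδ⟩
      symm := fun h => by
        obtain ⟨γ, hγ, δ, h₁, h₂⟩ := germRel_iff.1 h
        exact germRel_iff.2 ⟨γ, hγ, δ, h₂, h₁⟩
      trans := fun {p q r} h h' => by
        obtain ⟨γ, hγ, δ, h₁, h₂⟩ := germRel_iff.1 h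
        obtain ⟨γ', hγ', δ', h₁', h₂'⟩ := germRel_iff.1 h'
        obtain ⟨η, hη, k, k'⟩ := F.2.1.2.2 γ hγ γ' hγ'
        obtain ⟨ε, hε, -⟩ := p.mem.initial h₁ k
        refine germRel_iff.2 ⟨η, hη, ε, hε, ?_⟩
        rw [← q.mem.agree r.mem h₁' h₂' k', ← p.mem.agree q.mem h₁ h₂ k]
        exact hε }

theorem translate_trans {hC : LeftCancellative C} {f g : Mor C ≃. Mor C} (hf : InS hC f)
    (F : Set (Mor C)) : translate (g.trans f) F = translate f (translate g F) := by
  ext α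
  constructor
  · rintro ⟨γ, hγ, δ, hδ, h⟩
    obtain ⟨t, ht, hδ⟩ := (PEquiv.mem_trans _ _ _ _).1 hδ
    exact ⟨t, ⟨γ, hγ, t, ht, Initial.refl _⟩, δ, hδ, h⟩
  · rintro ⟨β, ⟨γ, hγ, t, ht, hβ⟩, δ, hδ, h⟩
    obtain ⟨δ', hδ', h'⟩ := hf.initial hδ hβ
    exact ⟨γ, hγ, δ', (PEquiv.mem_trans _ _ _ _).2 ⟨t, ht, hδ'⟩, h.trans h'⟩

theorem translate_idem {hC : LeftCancellative C} {e : Mor C ≃. Mor C} (he : InS hC e)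
    (hee : ∀ x y, y ∈ e x → y = x) {F : Set (Mor C)} (hF : F ∈ starSets C)
    (hne : (F ∩ dom e).Nonempty) : translate e F = F := by
  ext α
  constructor
  · rintro ⟨γ, hγ, δ, hδ, h⟩
    obtain rfl := hee _ _ hδ
    exact hF.2.1 _ _ h hγ
  · intro hα
    obtain ⟨γ, hγ, δ, hδ⟩ := hne
    obtain rfl := hee _ _ hδ
    obtain ⟨η, hη, h₁, h₂⟩ := hF.2.2 α hα δ hγ
    obtain ⟨ε, hε, -⟩ := he.initial hδ h₂
    obtain rfl := hee _ _ hε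
    exact ⟨ε, hη, ε, hε, h₁⟩

/-- `(s, F)(t, G) = (st, G)` for `t · G = F`. -/
def PreGerm.mul {hC : LeftCancellative C} {G F H : TightSpace C} (p : PreGerm hC F H)
    (q : PreGerm hC G F) : PreGerm hC G H where
  elt := q.elt.trans p.elt
  mem := InS.mul p.mem q.mem
  meets := by
    obtain ⟨α, hα, δ, hδ⟩ := p.meets
    rw [← q.translate_eq] at hα
    obtain ⟨γ, hγ, t, ht, h⟩ := hα
    obtain ⟨δ', hδ', -⟩ := p.mem.initial hδ h
    exact ⟨γ, hγ, δ', (PEquiv.mem_trans _ _ _ _).2 ⟨t, ht, hδ'⟩⟩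
  translate_eq := by
    rw [translate_trans p.mem, q.translate_eq, p.translate_eq]

/-- `(s, F)⁻¹ = (s^*, s · F)`. -/
def PreGerm.inv {hC : LeftCancellative C} {F H : TightSpace C} (p : PreGerm hC F H) :
    PreGerm hC H F where
  elt := p.elt.symm
  mem := p.mem.symm
  meets := by
    obtain ⟨γ, hγ, δ, hδ⟩ := p.meets
    refine ⟨δ, ?_, γ, (PEquiv.mem_iff_mem _).2 hδ⟩
    rw [← p.translate_eq]
    exact ⟨γ, hγ, δ, hδ, Initial.refl _⟩
  translate_eq := by
    rw [← p.translate_eq, ← translate_trans p.mem.symm]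
    refine translate_idem (InS.mul p.mem.symm p.mem) ?_ F.2.1 ?_
    · intro x y h
      obtain ⟨t, ht, hy⟩ := (PEquiv.mem_trans _ _ _ _).1 h
      exact p.elt.inj ((PEquiv.mem_iff_mem _).1 hy) ht
    · obtain ⟨γ, hγ, δ, hδ⟩ := p.meets
      exact ⟨γ, hγ, γ, (PEquiv.mem_trans _ _ _ _).2 ⟨δ, hδ, (PEquiv.mem_iff_mem _).2 hδ⟩⟩

/-- The pair `(e, F)` where `e = τ^γ σ^γ` is the identity of `γΛ` for some `γ ∈ F`. -/
noncomputable def PreGerm.id (hC : LeftCancellative C) (F : TightSpace C) : PreGerm hC F F where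
  elt := (sigma hC F.2.1.1.some).trans (tau hC F.2.1.1.some)
  mem := InS.mul (.tau _) (.sigma _)
  meets := ⟨_, F.2.1.1.some_mem, _, mem_sigma_trans_tau.2 ⟨rfl, Initial.refl _⟩⟩
  translate_eq := translate_idem (InS.mul (.tau _) (.sigma _))
    (fun _ _ h => (mem_sigma_trans_tau.1 h).1) F.2.1
    ⟨_, F.2.1.1.some_mem, _, mem_sigma_trans_tau.2 ⟨rfl, Initial.refl _⟩⟩

theorem PreGerm.mul_congr {hC : LeftCancellative C} {G F H : TightSpace C}
    {p p' : PreGerm hC F H} {q q' : PreGerm hC G F} (h : GermRel hC p p')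
    (h' : GermRel hC q q') : GermRel hC (p.mul q) (p'.mul q') := by
  obtain ⟨γ, hγ, δ, h₁, h₂⟩ := germRel_iff.1 h
  obtain ⟨ζ, hζ, ε, k₁, k₂⟩ := germRel_iff.1 h'
  rw [← q.translate_eq] at hγ
  obtain ⟨ξ, hξ, t, ht, hγt⟩ := hγ
  obtain ⟨η, hη, l, l'⟩ := G.2.1.2.2 ζ hζ ξ hξ
  obtain ⟨t', ht', m⟩ := q.mem.initial ht l'
  obtain ⟨δ', hδ', -⟩ := p.mem.initial h₁ (hγt.trans m)
  refine germRel_iff.2 ⟨η, hη, δ', (PEquiv.mem_trans _ _ _ _).2 ⟨t', ht', hδ'⟩,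
    (PEquiv.mem_trans _ _ _ _).2 ⟨t', ?_, ?_⟩⟩
  · rwa [← q.mem.agree q'.mem k₁ k₂ l]
  · rwa [← p.mem.agree p'.mem h₁ h₂ (hγt.trans m)]

theorem PreGerm.inv_congr {hC : LeftCancellative C} {F H : TightSpace C}
    {p p' : PreGerm hC F H} (h : GermRel hC p p') : GermRel hC p.inv p'.inv := by
  obtain ⟨γ, hγ, δ, h₁, h₂⟩ := germRel_iff.1 h
  refine germRel_iff.2 ⟨δ, ?_, γ, (PEquiv.mem_iff_mem _).2 h₁, (PEquiv.mem_iff_mem _).2 h₂⟩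
  rw [← p.translate_eq]
  exact ⟨γ, hγ, δ, h₁, Initial.refl _⟩

/-- The tight groupoid: its units are the points of `Λ_tight`, and its elements are the
germs `[s, F]`, with source `F` and range `s · F`. -/
@[reducible]
noncomputable def tightGroupoid (hC : LeftCancellative C) : Groupoid (TightSpace C) where
  Hom F F' := Quotient (germSetoid hC F F')
  id F := Quotient.mk _ (PreGerm.id hC F)
  comp {_ _ _} q p := Quotient.map₂ (fun q p => PreGerm.mul p q)
    (fun _ _ h _ _ h' => PreGerm.mul_congr h' h) q p
  inv {_ _} p := Quotient.map PreGerm.inv (fun _ _ h => PreGerm.inv_congr h) p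
  id_comp {F F'} p := by
    induction p using Quotient.inductionOn with | _ p => ?_
    refine Quotient.sound (germRel_iff.2 ?_)
    obtain ⟨γ, hγ, δ, hδ⟩ := p.meets
    obtain ⟨η, hη, h₁, h₂⟩ := F.2.1.2.2 γ hγ _ F.2.1.1.some_mem
    obtain ⟨ε, hε, -⟩ := p.mem.initial hδ h₁
    exact ⟨η, hη, ε, (PEquiv.mem_trans _ _ _ _).2
      ⟨η, mem_sigma_trans_tau.2 ⟨rfl, h₂⟩, hε⟩, hε⟩
  comp_id {F F'} p := by
    induction p using Quotient.inductionOn with | _ p => ?_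
    refine Quotient.sound (germRel_iff.2 ?_)
    obtain ⟨γ, hγ, δ, hδ, hi⟩ := p.translate_eq.symm.subset F'.2.1.1.some_mem
    refine ⟨γ, hγ, δ, (PEquiv.mem_trans _ _ _ _).2 ⟨δ, hδ, ?_⟩, hδ⟩
    exact mem_sigma_trans_tau.2 ⟨rfl, hi⟩
  assoc p q r := by
    induction p using Quotient.inductionOn with | _ p => ?_
    induction q using Quotient.inductionOn with | _ q => ?_
    induction r using Quotient.inductionOn with | _ r => ?_
    refine congrArg (Quotient.mk _) ?_
    simp only [PreGerm.mul, PEquiv.trans_assoc]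
  inv_comp {F F'} p := by
    induction p using Quotient.inductionOn with | _ p => ?_
    refine Quotient.sound (germRel_iff.2 ?_)
    obtain ⟨γ, hγ, δ, hδ, hi⟩ := p.translate_eq.symm.subset F'.2.1.1.some_mem
    refine ⟨δ, p.translate_eq.subset ⟨γ, hγ, δ, hδ, Initial.refl _⟩, δ, (PEquiv.mem_trans _ _ _ _).2 ⟨γ, (PEquiv.mem_iff_mem _).2 hδ, hδ⟩,
      mem_sigma_trans_tau.2 ⟨rfl, hi⟩⟩
  comp_inv {F F'} p := by
    induction p using Quotient.inductionOn with | _ p => ?_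
    refine Quotient.sound (germRel_iff.2 ?_)
    obtain ⟨γ, hγ, δ, hδ⟩ := p.meets
    obtain ⟨η, hη, h₁, h₂⟩ := F.2.1.2.2 γ hγ _ F.2.1.1.some_mem
    obtain ⟨ε, hε, -⟩ := p.mem.initial hδ h₁
    exact ⟨η, hη, η, (PEquiv.mem_trans _ _ _ _).2 ⟨ε, hε, (PEquiv.mem_iff_mem _).2 hε⟩,
      mem_sigma_trans_tau.2 ⟨rfl, h₂⟩⟩

/-- The set of all elements of the tight groupoid. -/
abbrev GTight (hC : LeftCancellative C) := Mor (tightGroupoid hC).toCategory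

/-- `Θ(s, U)`, the set of the germs `[s, F]` with `F ∈ U` and `F ∩ dom(s) ≠ ∅`. -/
def Theta (hC : LeftCancellative C) (s : Mor C ≃. Mor C) (U : Set (TightSpace C)) :
    Set (GTight hC) :=
  {x | ∃ (F F' : TightSpace C) (p : PreGerm hC F F'), F ∈ U ∧ p.elt = s ∧
    x = ⟨F, F', Quotient.mk (germSetoid hC F F') p⟩}

/-- The topology generated by the sets `Θ(s, U)`, with `s` in the semigroup and `U` open. -/
instance (hC : LeftCancellative C) : TopologicalSpace (GTight hC) :=
  TopologicalSpace.generateFrom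
    {W | ∃ (s : Mor C ≃. Mor C) (U : Set (TightSpace C)), InS hC s ∧ IsOpen U ∧
      W = Theta hC s U}

end Tight

/-- A groupoid with a topology on its set of elements is minimal if the only invariant subsets of
its unit space that are open (for the topology induced by the inclusion of the units in the
groupoid) are the empty set and the whole unit space. -/
def IsMinimal {X : Type u} (𝒢 : Groupoid.{v} X) [TopologicalSpace (Mor 𝒢.toCategory)] : Prop :=
  ∀ U : Set X,
    (TopologicalSpace.induced (fun x : X => (⟨x, x, 𝒢.id x⟩ : Mor 𝒢.toCategory))
      inferInstance).IsOpen U →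
    (∀ x y : X, 𝒢.Hom x y → x ∈ U → y ∈ U) → U = ∅ ∨ U = Set.univ

end LCSC

namespace LCSC

/-! ### Hereditary directed sets -/

section StarSets

variable {V : Type*} {C : Category V}

/-! The equivalence of minimality with the exhaustive-set condition holds for every finitely aligned
left cancellative category (`isMinimal_iff_exists_FE`); it is then applied to the Zappa-Szép product
and read off in `Λ`.

For a morphism `β`, the tight sets containing some `γ` with `s(β)Λs(γ) ≠ ∅` form a nonempty open
invariant set. If the groupoid is minimal, every tight set contains such a `γ`, and compactness of
the tight sets containing `α` leaves finitely many `γ`, which form an exhaustive set of `α`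
(`exists_FE_subset`). Compactness appears as an ultrafilter argument: finite alignment makes a
nonempty ultrafilter limit of maximal sets tight.

Conversely, a nonempty open set contains the cylinder of all tight sets through some `β`
(`exists_cylinder_subset`). A tight set `G` through `α` meets each exhaustive set of `α`
(`exists_mem_of_mem_FE`), so it contains some `γ` with a morphism `f` from `s(γ)` to `s(β)`. The
germ of `τ^{βf} σ^γ` moves `G` into the cylinder, so an invariant open set containing the cylinder
contains `G`.

In the Zappa-Szép product, whether `(α, g)` extends to `(η, k)` depends only on `α` and `η`, because
groupoid elements are invertible (`CategorySystem.initial_iff`). Hence finite alignment and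
exhaustive sets transfer in both directions. A morphism of the product is a morphism of `Λ` together
with a groupoid element, which accounts for the orbit in the last condition. -/

theorem Meets.of_mem {D : Set (Mor C)} (hD : D ∈ starSets C) {α β : Mor C} (hα : α ∈ D)
    (hβ : β ∈ D) : Meets α β := by
  obtain ⟨γ, -, h₁, h₂⟩ := hD.2.2 α hα β hβ
  exact ⟨γ, h₁, h₂⟩

theorem Initial.tgt_eq {α β : Mor C} (h : Initial α β) : β.tgt = α.tgt := by
  obtain ⟨ε, rfl⟩ := h
  rfl

theorem exists_upperBound {D : Set (Mor C)} (hD : D ∈ starSets C) (X : Finset (Mor C))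
    (hX : (X : Set (Mor C)) ⊆ D) : ∃ β ∈ D, ∀ x ∈ X, Initial x β := by
  classical
  induction X using Finset.induction_on with
  | empty => exact ⟨_, hD.1.some_mem, by simp⟩
  | insert a X _ ih =>
    rw [Finset.coe_insert, Set.insert_subset_iff] at hX
    obtain ⟨β, hβ, h⟩ := ih hX.2
    obtain ⟨γ, hγ, h₁, h₂⟩ := hD.2.2 a hX.1 β hβ
    refine ⟨γ, hγ, fun x hx => ?_⟩
    rcases Finset.mem_insert.1 hx with rfl | hx
    · exact h₁
    · exact (h x hx).trans h₂

/-- The set `[β]` of the initial segments of `β`. -/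
def segments (β : Mor C) : Set (Mor C) := {α | Initial α β}

theorem segments_mem_starSets (β : Mor C) : segments β ∈ starSets C :=
  ⟨⟨β, Initial.refl β⟩, fun _ _ h h' => Initial.trans h h',
    fun _ h _ h' => ⟨β, Initial.refl β, h, h'⟩⟩

theorem exists_maximal_superset {F : Set (Mor C)} (hF : F ∈ starSets C) :
    ∃ D ∈ maximalSets C, F ⊆ D := by
  obtain ⟨D, hFD, hD⟩ := zorn_subset_nonempty (starSets C) (fun c hc hchain hne => by
    refine ⟨⋃₀ c, ⟨?_, ?_, ?_⟩, fun s hs => Set.subset_sUnion_of_mem hs⟩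
    · obtain ⟨s, hs⟩ := hne
      obtain ⟨x, hx⟩ := (hc hs).1
      exact ⟨x, s, hs, hx⟩
    · rintro α β h ⟨s, hs, hβ⟩
      exact ⟨s, hs, (hc hs).2.1 α β h hβ⟩
    · rintro α ⟨s, hs, hα⟩ β ⟨t, ht, hβ⟩
      obtain ⟨r, hr, hsr, htr⟩ := hchain.directedOn s hs t ht
      obtain ⟨γ, hγ, h⟩ := (hc hr).2.2 α (hsr hα) β (htr hβ)
      exact ⟨γ, ⟨r, hr, hγ⟩, h⟩) F hF
  exact ⟨D, ⟨hD.prop, fun E hE h => (hD.le_of_ge hE h).antisymm h⟩, hFD⟩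

theorem exists_maximal_mem (β : Mor C) : ∃ D ∈ maximalSets C, β ∈ D := by
  obtain ⟨D, hD, h⟩ := exists_maximal_superset (segments_mem_starSets β)
  exact ⟨D, hD, h (Initial.refl β)⟩

theorem maximalSets_subset_tightSets : maximalSets C ⊆ tightSets C :=
  fun D hD => ⟨hD.1, fun _ hα _ hK => ⟨D, hD, hα, hK⟩⟩

/-- The limit of a family of sets along an ultrafilter. -/
def ultralimit {ι X : Type*} (𝒰 : Ultrafilter ι) (D : ι → Set X) : Set X :=
  {x | ∀ᶠ i in 𝒰, x ∈ D i}

/-- Directedness is the only point that needs finite alignment: upper bounds of `α` and `β` may vary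
with the index, but each lies above one of finitely many minimal candidates, and the ultrafilter
selects one of these. -/
theorem ultralimit_mem_starSets (hfa : FinitelyAligned C) {ι : Type*} (𝒰 : Ultrafilter ι)
    {D : ι → Set (Mor C)} (hD : ∀ i, D i ∈ starSets C) (hne : (ultralimit 𝒰 D).Nonempty) :
    ultralimit 𝒰 D ∈ starSets C := by
  refine ⟨hne, fun α β h hβ => Filter.Eventually.mono hβ fun i hi => (hD i).2.1 α β h hi,
    fun α hα β hβ => ?_⟩
  obtain ⟨Γ, hΓ⟩ := hfa α β
  have key : ∀ᶠ i in (𝒰 : Filter ι), ∃ γ ∈ (Γ : Set (Mor C)), γ ∈ D i := by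
    filter_upwards [hα, hβ] with i hi hi'
    obtain ⟨δ, hδ, h₁, h₂⟩ := (hD i).2.2 α hi β hi'
    have h : δ ∈ ideal α ∩ ideal β := ⟨h₁, h₂⟩
    rw [hΓ] at h
    obtain ⟨γ, hγ, h⟩ := Set.mem_iUnion₂.1 h
    exact ⟨γ, hγ, (hD i).2.1 γ δ h hδ⟩
  -- A finite union belonging to an ultrafilter has a member belonging to it; this fixes one `γ` for
  -- almost all indices.
  have key' : ⋃ γ ∈ (Γ : Set (Mor C)), {i | γ ∈ D i} ∈ 𝒰 := by
    filter_upwards [key] with i hi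
    simpa using hi
  obtain ⟨γ, hγ, h⟩ := (Ultrafilter.finite_biUnion_mem_iff Γ.finite_toSet).1 key'
  have hm : γ ∈ ideal α ∩ ideal β := by
    rw [hΓ]
    exact Set.mem_iUnion₂.2 ⟨γ, hγ, Initial.refl γ⟩
  exact ⟨γ, h, hm.1, hm.2⟩

/-- Membership of `α` and avoidance of the finite set `K` each hold for almost all indices, so some
`D i` is itself the maximal set that tightness requires. -/
theorem ultralimit_mem_tightSets (hfa : FinitelyAligned C) {ι : Type*} (𝒰 : Ultrafilter ι)
    {D : ι → Set (Mor C)} (hD : ∀ i, D i ∈ maximalSets C) (hne : (ultralimit 𝒰 D).Nonempty) :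
    ultralimit 𝒰 D ∈ tightSets C := by
  refine ⟨ultralimit_mem_starSets hfa 𝒰 (fun i => (hD i).1) hne, fun α hα K hK => ?_⟩
  have hK' : ∀ᶠ i in (𝒰 : Filter ι), ∀ k ∈ K, k ∉ D i :=
    (Filter.eventually_all_finset K).2 fun k hk =>
      Ultrafilter.eventually_not.2 fun h => Set.disjoint_left.1 hK h hk
  obtain ⟨i, hi, hi'⟩ := (Filter.Eventually.and hα hK').exists
  exact ⟨D i, hD i, hi, Set.disjoint_right.2 hi'⟩

/-- A maximal set contains every morphism that has common extensions with all its elements. -/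
theorem mem_of_forall_meets (hfa : FinitelyAligned C) {D : Set (Mor C)} (hD : D ∈ maximalSets C)
    {α : Mor C} (h : ∀ β ∈ D, Meets α β) : α ∈ D := by
  classical
  -- Every finite part of `D` has an upper bound in `D`, which meets `α` by hypothesis; `z` is a
  -- common extension.
  have hX : ∀ X : Finset D, ∃ z, Initial α z ∧ ∀ x ∈ X, Initial x.1 z := by
    intro X
    obtain ⟨β, hβ, hX⟩ := exists_upperBound hD.1 (X.image Subtype.val) (by
      intro x hx
      obtain ⟨y, -, rfl⟩ := Finset.mem_image.1 hx
      exact y.2)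
    obtain ⟨z, h₁, h₂⟩ := h β hβ
    exact ⟨z, h₁, fun x hx => (hX x (Finset.mem_image_of_mem _ hx)).trans h₂⟩
  choose z hαz hz using hX
  -- Since `𝒰` refines `atTop`, each fixed element of `D` lies in almost all `X`. The limit of the
  -- sets `[z X]` thus contains `D` and `α`, and maximality of `D` makes it equal to `D`.
  let 𝒰 : Ultrafilter (Finset D) := Ultrafilter.of Filter.atTop
  have hmem : α ∈ ultralimit 𝒰 fun X => segments (z X) := Filter.Eventually.of_forall hαz
  have hsub : D ⊆ ultralimit 𝒰 fun X => segments (z X) := fun x hx =>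
    Filter.Eventually.filter_mono (Ultrafilter.of_le _) <| by
      filter_upwards [Filter.eventually_ge_atTop {⟨x, hx⟩}] with X hX
      exact hz X ⟨x, hx⟩ (Finset.singleton_subset_iff.1 hX)
  have hE := hD.2 _ (ultralimit_mem_starSets hfa 𝒰 (fun X => segments_mem_starSets (z X))
    ⟨α, hmem⟩) hsub
  rwa [hE] at hmem

/-- If a maximal set is disjoint from a finite set `K`, then one of its elements has no common
extension with any element of `K`. -/
theorem exists_not_meets (hfa : FinitelyAligned C) {D : Set (Mor C)} (hD : D ∈ maximalSets C)
    {α : Mor C} (hα : α ∈ D) {K : Finset (Mor C)} (hK : Disjoint D (K : Set (Mor C))) :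
    ∃ β ∈ D, Initial α β ∧ ∀ k ∈ K, ¬ Meets k β := by
  classical
  have hk : ∀ k ∈ K, ∃ β ∈ D, ¬ Meets k β := by
    intro k hk
    by_contra! h
    exact Set.disjoint_right.1 hK hk (mem_of_forall_meets hfa hD h)
  choose! b hbD hb using hk
  -- Whatever is disjoint from `b k` stays disjoint from its extensions, so an upper bound of `α`
  -- and all the `b k` avoids the whole of `K` at once.
  obtain ⟨β, hβ, h⟩ := exists_upperBound hD.1 (insert α (K.image b)) (by
    intro x hx
    rcases Finset.mem_insert.1 hx with rfl | hx
    · exact hα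
    · obtain ⟨k, hk, rfl⟩ := Finset.mem_image.1 hx
      exact hbD k hk)
  refine ⟨β, hβ, h α (Finset.mem_insert_self _ _), fun k hk ⟨δ, h₁, h₂⟩ => hb k hk ⟨δ, h₁, ?_⟩⟩
  exact (h (b k) (Finset.mem_insert_of_mem (Finset.mem_image_of_mem _ hk))).trans h₂

/-- A tight set that contains `α` meets every finite exhaustive set of `α`. -/
theorem exists_mem_of_mem_FE (hfa : FinitelyAligned C) {F : Set (Mor C)} (hF : F ∈ tightSets C)
    {α : Mor C} (hα : α ∈ F) {K : Finset (Mor C)} (hK : K ∈ FE α) : ∃ γ ∈ K, γ ∈ F := by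
  by_contra! h
  obtain ⟨D, hD, hαD, hKD⟩ := hF.2 α hα K (Set.disjoint_right.2 h)
  obtain ⟨β, -, hαβ, hβ⟩ := exists_not_meets hfa hD hαD hKD
  obtain ⟨k, hk, hm⟩ := hK.2 β hαβ
  exact hβ k hk hm

/-- If every tight set contains an element of `S`, then every `α` has a finite exhaustive set
contained in `S`. -/
theorem exists_FE_subset (hfa : FinitelyAligned C) {S : Set (Mor C)}
    (hS : ∀ F ∈ tightSets C, ∃ γ ∈ F, γ ∈ S) (α : Mor C) :
    ∃ F ∈ FE α, (F : Set (Mor C)) ⊆ S := by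
  classical
  by_contra! hcon
  -- Members of an exhaustive set of `α` must have range `r(α)`, hence the restriction on `S`. If no
  -- finite `X ⊆ T` is exhaustive, some extension of `α` meets nothing in `X`, and a maximal set
  -- through it avoids `X`.
  let T : Set (Mor C) := {γ | γ ∈ S ∧ γ.tgt = α.tgt}
  have hX : ∀ X : Finset T, ∃ D ∈ maximalSets C, α ∈ D ∧ ∀ x ∈ X, x.1 ∉ D := by
    intro X
    have hnot : X.image Subtype.val ∉ FE α := fun h => hcon _ h (by
      intro x hx
      obtain ⟨y, -, rfl⟩ := Finset.mem_image.1 hx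
      exact y.2.1)
    have : ∃ γ ∈ ideal α, ∀ β ∈ X.image Subtype.val, ¬ Meets β γ := by
      by_contra! h
      refine hnot ⟨fun β hβ => ?_, h⟩
      obtain ⟨y, -, rfl⟩ := Finset.mem_image.1 hβ
      exact y.2.2
    obtain ⟨γ, hγ, h⟩ := this
    obtain ⟨D, hD, hγD⟩ := exists_maximal_mem γ
    exact ⟨D, hD, hD.1.2.1 α γ hγ hγD, fun x hx hxD =>
      h x (Finset.mem_image_of_mem _ hx) (Meets.of_mem hD.1 hxD hγD)⟩
  choose D hD hαD hXD using hX
  -- The limit is a tight set through `α` that avoids all of `T`. Its element in `S` shares an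
  -- extension with `α`, so it has range `r(α)` and lies in `T`: a contradiction.
  let 𝒰 : Ultrafilter (Finset T) := Ultrafilter.of Filter.atTop
  have hα : α ∈ ultralimit 𝒰 D := Filter.Eventually.of_forall hαD
  have htight := ultralimit_mem_tightSets hfa 𝒰 hD ⟨α, hα⟩
  obtain ⟨γ, hγ, hγS⟩ := hS _ htight
  obtain ⟨δ, -, h₁, h₂⟩ := htight.1.2.2 α hα γ hγ
  have hγT : γ ∈ T := ⟨hγS, h₂.tgt_eq.symm.trans h₁.tgt_eq⟩
  have hev : ∀ᶠ X in (𝒰 : Filter (Finset T)), γ ∉ D X :=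
    Filter.Eventually.filter_mono (Ultrafilter.of_le _) <| by
      filter_upwards [Filter.eventually_ge_atTop {⟨γ, hγT⟩}] with X hX
      exact hXD X ⟨γ, hγT⟩ (Finset.singleton_subset_iff.1 hX)
  obtain ⟨X, h, h'⟩ := (Filter.Eventually.and hγ hev).exists
  exact h' h

end StarSets

/-! ### Translates of tight sets -/

section Translate

variable {V : Type*} {C : Category V} {hC : LeftCancellative C} {t : Mor C ≃. Mor C}

theorem translate_mono {F D : Set (Mor C)} (h : F ⊆ D) : translate t F ⊆ translate t D :=
  fun _ ⟨γ, hγ, h'⟩ => ⟨γ, h hγ, h'⟩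

theorem mem_translate {F : Set (Mor C)} {x y : Mor C} (hx : x ∈ F) (hxy : y ∈ t x) :
    y ∈ translate t F := ⟨x, hx, y, hxy, Initial.refl y⟩

theorem translate_mem_starSets (ht : InS hC t) {F : Set (Mor C)} (hF : F ∈ starSets C)
    (hne : (F ∩ dom t).Nonempty) : translate t F ∈ starSets C := by
  refine ⟨?_, ?_, ?_⟩
  · obtain ⟨x, hx, y, hxy⟩ := hne
    exact ⟨y, mem_translate hx hxy⟩
  · rintro α β h ⟨γ, hγ, δ, hδ, h'⟩
    exact ⟨γ, hγ, δ, hδ, h.trans h'⟩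
  · rintro α ⟨γ, hγ, δ, hδ, h⟩ α' ⟨γ', hγ', δ', hδ', h'⟩
    obtain ⟨η, hη, k, k'⟩ := hF.2.2 γ hγ γ' hγ'
    obtain ⟨ε, hε, l⟩ := ht.initial hδ k
    obtain ⟨ε', hε', l'⟩ := ht.initial hδ' k'
    obtain rfl := Option.mem_unique hε hε'
    exact ⟨ε, mem_translate hη hε, h.trans l, h'.trans l'⟩

theorem translate_symm_translate (ht : InS hC t) {F : Set (Mor C)} (hF : F ∈ starSets C)
    (hne : (F ∩ dom t).Nonempty) : translate t.symm (translate t F) = F := by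
  rw [← translate_trans ht.symm]
  refine translate_idem (InS.mul ht.symm ht) ?_ hF ?_
  · intro x y h
    obtain ⟨s, hs, hy⟩ := (PEquiv.mem_trans _ _ _ _).1 h
    exact t.inj ((PEquiv.mem_iff_mem _).1 hy) hs
  · obtain ⟨γ, hγ, δ, hδ⟩ := hne
    exact ⟨γ, hγ, γ, (PEquiv.mem_trans _ _ _ _).2 ⟨δ, hδ, (PEquiv.mem_iff_mem _).2 hδ⟩⟩

theorem translate_translate_symm (ht : InS hC t) {F : Set (Mor C)} (hF : F ∈ starSets C)
    (hne : (F ∩ dom t.symm).Nonempty) : translate t (translate t.symm F) = F := by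
  have h := translate_symm_translate ht.symm hF hne
  rwa [PEquiv.symm_symm] at h

/-- Translation by `t` and by its inverse are monotone and mutually inverse, so a larger directed
set above `t · F` pulls back to one above `F`. -/
theorem translate_mem_maximalSets (ht : InS hC t) {F : Set (Mor C)} (hF : F ∈ maximalSets C)
    (hne : (F ∩ dom t).Nonempty) : translate t F ∈ maximalSets C := by
  refine ⟨translate_mem_starSets ht hF.1 hne, fun D hD h => ?_⟩
  have hneD : (D ∩ dom t.symm).Nonempty := by
    obtain ⟨x, hx, y, hxy⟩ := hne
    exact ⟨y, h (mem_translate hx hxy), x, (PEquiv.mem_iff_mem _).2 hxy⟩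
  have hsub : F ⊆ translate t.symm D := by
    rw [← translate_symm_translate ht hF.1 hne]
    exact translate_mono h
  rw [← hF.2 _ (translate_mem_starSets ht.symm hD hneD) hsub, translate_translate_symm ht hD hneD]

/-- For `z` above `t x`, `z ∈ t · F` iff `t⁻¹ z ∈ F`. -/
theorem mem_translate_iff (ht : InS hC t) {F : Set (Mor C)} (hF : F ∈ starSets C)
    {w z : Mor C} (hwz : z ∈ t w) (hne : (F ∩ dom t).Nonempty) :
    z ∈ translate t F ↔ w ∈ F := by
  refine ⟨fun h => ?_, fun h => mem_translate h hwz⟩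
  rw [← translate_symm_translate ht hF hne]
  exact mem_translate h ((PEquiv.mem_iff_mem _).2 hwz)

/-- The obstruction `K` for `t · F` is pulled back to a finite obstruction for `F`. A maximal set
through `γ` avoiding the latter is then translated by `t`. -/
theorem translate_mem_tightSets (hfa : FinitelyAligned C) (ht : InS hC t) {F : Set (Mor C)}
    (hF : F ∈ tightSets C) (hne : (F ∩ dom t).Nonempty) : translate t F ∈ tightSets C := by
  classical
  have hstar := translate_mem_starSets ht hF.1 hne
  refine ⟨hstar, ?_⟩
  rintro α ⟨γ, hγ, δ, hδ, hαδ⟩ K hK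
  -- An element `k` need not lie in the range of `t`. But `δ` is in `t · D`, so `k` is in `t · D`
  -- exactly when one of the finitely many generators of `kΛ ∩ δΛ` is; these extend `δ` and do have
  -- preimages, collected in `L`.
  have hk : ∀ k : Mor C, ∃ L : Finset (Mor C), ∀ D ∈ starSets C, γ ∈ D →
      (k ∈ translate t D ↔ ∃ l ∈ L, l ∈ D) := by
    intro k
    obtain ⟨Δ, hΔ⟩ := hfa k δ
    have hpre : ∀ z ∈ Δ, ∃ w, z ∈ t w := by
      intro z hz
      have h : z ∈ ideal k ∩ ideal δ := by
        rw [hΔ]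
        exact Set.mem_iUnion₂.2 ⟨z, hz, Initial.refl z⟩
      obtain ⟨w, hw, -⟩ := ht.symm.initial ((PEquiv.mem_iff_mem _).2 hδ) h.2
      exact ⟨w, (PEquiv.mem_iff_mem _).1 hw⟩
    choose! w hw using hpre
    refine ⟨Δ.image w, fun D hD hγD => ?_⟩
    have hneD : (D ∩ dom t).Nonempty := ⟨γ, hγD, δ, hδ⟩
    have hsD := translate_mem_starSets ht hD hneD
    constructor
    · intro hkD
      obtain ⟨x, hx, h₁, h₂⟩ := hsD.2.2 k hkD δ (mem_translate hγD hδ)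
      have h : x ∈ ideal k ∩ ideal δ := ⟨h₁, h₂⟩
      rw [hΔ] at h
      obtain ⟨z, hz, h⟩ := Set.mem_iUnion₂.1 h
      exact ⟨w z, Finset.mem_image_of_mem _ hz,
        (mem_translate_iff ht hD (hw z hz) hneD).1 (hsD.2.1 z x h hx)⟩
    · rintro ⟨l, hl, hlD⟩
      obtain ⟨z, hz, rfl⟩ := Finset.mem_image.1 hl
      have h : z ∈ ideal k ∩ ideal δ := by
        rw [hΔ]
        exact Set.mem_iUnion₂.2 ⟨z, hz, Initial.refl z⟩
      exact hsD.2.1 k z h.1 (mem_translate hlD (hw z hz))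
  choose L hL using hk
  obtain ⟨D, hD, hγD, hdis⟩ := hF.2 γ hγ (K.biUnion L) (by
    refine Set.disjoint_right.2 fun l hl hlF => ?_
    obtain ⟨k, hkK, hlk⟩ := Finset.mem_biUnion.1 hl
    exact Set.disjoint_right.1 hK hkK ((hL k F hF.1 hγ).2 ⟨l, hlk, hlF⟩))
  refine ⟨translate t D, translate_mem_maximalSets ht hD ⟨γ, hγD, δ, hδ⟩, ⟨γ, hγD, δ, hδ, hαδ⟩,
    Set.disjoint_right.2 fun k hkK hkD => ?_⟩
  obtain ⟨l, hlk, hlD⟩ := (hL k D hD.1 hγD).1 hkD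
  exact Set.disjoint_right.1 hdis (Finset.mem_biUnion.2 ⟨k, hkK, hlk⟩) hlD

end Translate

/-! ### The topology of the unit space -/

section Topology

variable {V : Type*} {C : Category V}

theorem isOpen_setOf_mem (γ : Mor C) : IsOpen {F : TightSpace C | γ ∈ F.1} :=
  TopologicalSpace.isOpen_generateFrom_of_mem ⟨{γ}, ∅, by ext F; simp⟩

theorem exists_finset_of_isOpen {U : Set (TightSpace C)} (hU : IsOpen U) {F : TightSpace C}
    (hF : F ∈ U) : ∃ X Y : Finset (Mor C), ((X : Set (Mor C)) ⊆ F.1 ∧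
      Disjoint F.1 (Y : Set (Mor C))) ∧ ∀ G : TightSpace C,
        (X : Set (Mor C)) ⊆ G.1 → Disjoint G.1 (Y : Set (Mor C)) → G ∈ U := by
  classical
  induction hU with
  | basic U h =>
    obtain ⟨X, Y, rfl⟩ := h
    exact ⟨X, Y, hF, fun G h h' => ⟨h, h'⟩⟩
  | univ => exact ⟨∅, ∅, by simp, fun _ _ _ => trivial⟩
  | inter U U' _ _ ih ih' =>
    obtain ⟨X, Y, h, k⟩ := ih hF.1
    obtain ⟨X', Y', h', k'⟩ := ih' hF.2
    refine ⟨X ∪ X', Y ∪ Y', ?_, fun G => ?_⟩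
    · rw [Finset.coe_union, Finset.coe_union]
      exact ⟨Set.union_subset h.1 h'.1, Set.disjoint_union_right.2 ⟨h.2, h'.2⟩⟩
    · rw [Finset.coe_union, Finset.coe_union, Set.union_subset_iff, Set.disjoint_union_right]
      exact fun hX hY => ⟨k G hX.1 hY.1, k' G hX.2 hY.2⟩
  | sUnion 𝒮 _ ih =>
    obtain ⟨U, hU, hFU⟩ := hF
    obtain ⟨X, Y, h, k⟩ := ih U hU hFU
    exact ⟨X, Y, h, fun G hX hY => ⟨U, hU, k G hX hY⟩⟩

/-- A non-empty open set of tight sets contains all tight sets that contain some morphism `β`. -/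
theorem exists_cylinder_subset (hfa : FinitelyAligned C) {U : Set (TightSpace C)} (hU : IsOpen U)
    (hne : U.Nonempty) : ∃ β : Mor C, ∀ G : TightSpace C, β ∈ G.1 → G ∈ U := by
  obtain ⟨F, hF⟩ := hne
  obtain ⟨X, Y, ⟨hX, hY⟩, h⟩ := exists_finset_of_isOpen hU hF
  obtain ⟨α, hα, hXα⟩ := exists_upperBound F.2.1 X hX
  -- Tightness replaces `F` by a maximal set, where avoiding `Y` is witnessed by a single `β` that
  -- meets no element of `Y`.
  obtain ⟨D, hD, hαD, hYD⟩ := F.2.2 α hα Y hY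
  obtain ⟨β, -, hαβ, hβ⟩ := exists_not_meets hfa hD hαD hYD
  refine ⟨β, fun G hG => h G (fun x hx => G.2.1.2.1 x β ((hXα x hx).trans hαβ) hG) ?_⟩
  exact Set.disjoint_right.2 fun y hy hyG => hβ y hy (Meets.of_mem G.2.1 hyG hG)

/-- The inclusion of the units in the tight groupoid. -/
noncomputable def unitGerm (hC : LeftCancellative C) (F : TightSpace C) : GTight hC :=
  ⟨F, F, (tightGroupoid hC).id F⟩

/-- A germ `[s, F]` is a unit exactly when `s` fixes some `γ ∈ F`; then `s` is the identity on `γΛ`,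
which determines both `s · F` and the germ. -/
theorem unitGerm_mem_Theta (hC : LeftCancellative C) {s : Mor C ≃. Mor C} (hs : InS hC s)
    {U : Set (TightSpace C)} {F : TightSpace C} :
    unitGerm hC F ∈ Theta hC s U ↔ F ∈ U ∧ ∃ γ ∈ F.1, γ ∈ s γ := by
  constructor
  · rintro ⟨F₁, F₂, p, hU, rfl, h⟩
    simp only [unitGerm, Mor.mk.injEq] at h
    obtain ⟨rfl, rfl, h⟩ := h
    refine ⟨hU, ?_⟩
    obtain ⟨γ, hγ, δ, h₁, h₂⟩ := germRel_iff.1 (Quotient.exact (eq_of_heq h))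
    obtain ⟨rfl, -⟩ := mem_sigma_trans_tau.1 h₁
    exact ⟨δ, hγ, h₂⟩
  · rintro ⟨hU, γ, hγ, h⟩
    have htr : translate s F.1 = F.1 := by
      have hag : ∀ {x}, Initial γ x → x ∈ s x := by
        intro x hx
        have he : InS hC ((sigma hC γ).trans (tau hC γ)) := InS.mul (.tau _) (.sigma _)
        rw [← he.agree hs (mem_sigma_trans_tau.2 ⟨rfl, Initial.refl γ⟩) h hx]
        exact mem_sigma_trans_tau.2 ⟨rfl, hx⟩
      ext α
      constructor
      · rintro ⟨x, hx, y, hy, hα⟩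
        obtain ⟨η, hη, h₁, h₂⟩ := F.2.1.2.2 x hx γ hγ
        obtain ⟨ε, hε, hyε⟩ := hs.initial hy h₁
        obtain rfl := Option.mem_unique hε (hag h₂)
        exact F.2.1.2.1 α ε (hα.trans hyε) hη
      · intro hα
        obtain ⟨η, hη, h₁, h₂⟩ := F.2.1.2.2 α hα γ hγ
        exact ⟨η, hη, η, hag h₂, h₁⟩
    refine ⟨F, F, ⟨s, hs, ⟨γ, hγ, γ, h⟩, htr⟩, hU, rfl, ?_⟩
    refine congrArg (Mor.mk F F) (Quotient.sound (germRel_iff.2 ?_))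
    obtain ⟨η, hη, h₁, h₂⟩ := F.2.1.2.2 γ hγ _ F.2.1.1.some_mem
    have he : InS hC ((sigma hC γ).trans (tau hC γ)) := InS.mul (.tau _) (.sigma _)
    refine ⟨η, hη, η, mem_sigma_trans_tau.2 ⟨rfl, h₂⟩, ?_⟩
    change η ∈ s η
    rw [← he.agree hs (mem_sigma_trans_tau.2 ⟨rfl, Initial.refl γ⟩) h h₁]
    exact mem_sigma_trans_tau.2 ⟨rfl, h₁⟩

/-- The topology of the unit space of the tight groupoid is that of `Λ_tight`. -/
theorem isInducing_unitGerm (hC : LeftCancellative C) : Topology.IsInducing (unitGerm hC) := by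
  refine ⟨le_antisymm (continuous_iff_le_induced.1 (continuous_generateFrom_iff.2 ?_)) ?_⟩
  · rintro _ ⟨s, U, hs, hU, rfl⟩
    have h : unitGerm hC ⁻¹' Theta hC s U =
        U ∩ ⋃ γ ∈ {γ | γ ∈ s γ}, {F : TightSpace C | γ ∈ F.1} := by
      ext F
      rw [Set.mem_preimage, unitGerm_mem_Theta hC hs]
      simp [and_comm]
    rw [h]
    exact hU.inter (isOpen_biUnion fun γ _ => isOpen_setOf_mem γ)
  · intro U hU
    -- No single idempotent has a domain meeting every tight set, in general, so all the `τ^γ σ^γ`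
    -- are used together.
    refine isOpen_induced_iff.2 ⟨⋃ γ : Mor C, Theta hC ((sigma hC γ).trans (tau hC γ)) U,
      isOpen_iUnion fun γ => TopologicalSpace.isOpen_generateFrom_of_mem
        ⟨_, U, InS.mul (.tau _) (.sigma _), hU, rfl⟩, ?_⟩
    ext F
    simp only [Set.mem_preimage, Set.mem_iUnion]
    constructor
    · rintro ⟨γ, h⟩
      exact ((unitGerm_mem_Theta hC (InS.mul (.tau _) (.sigma _))).1 h).1
    · intro hF
      exact ⟨F.2.1.1.some, (unitGerm_mem_Theta hC (InS.mul (.tau _) (.sigma _))).2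
        ⟨hF, _, F.2.1.1.some_mem, mem_sigma_trans_tau.2 ⟨rfl, Initial.refl _⟩⟩⟩

theorem isMinimal_tightGroupoid_iff (hC : LeftCancellative C) :
    IsMinimal (tightGroupoid hC) ↔ ∀ U : Set (TightSpace C), IsOpen U →
      (∀ F G, PreGerm hC F G → F ∈ U → G ∈ U) → U = ∅ ∨ U = Set.univ := by
  have h : TopologicalSpace.induced (fun F : TightSpace C =>
      (⟨F, F, (tightGroupoid hC).id F⟩ : GTight hC)) inferInstance =
      (inferInstance : TopologicalSpace (TightSpace C)) := (isInducing_unitGerm hC).eq_induced.symm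
  unfold IsMinimal
  rw [h]
  refine forall_congr' fun U => imp_congr_right fun _ => imp_congr_left ?_
  exact ⟨fun hU F G p => hU F G (Quotient.mk _ p),
    fun hU F G p => Quotient.inductionOn p (hU F G)⟩

end Topology

/-! ### Minimality -/

section Minimal

variable {V : Type*} {C : Category V}

theorem isMinimal_iff_exists_FE (hC : LeftCancellative C) (hfa : FinitelyAligned C) :
    IsMinimal (tightGroupoid hC) ↔
      ∀ α β : Mor C, ∃ F ∈ FE α, ∀ γ ∈ F, Nonempty (C.Hom γ.src β.src) := by
  rw [isMinimal_tightGroupoid_iff]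
  constructor
  · intro h α β
    let S : Set (Mor C) := {γ | Nonempty (C.Hom γ.src β.src)}
    have hopen : IsOpen {F : TightSpace C | ∃ γ ∈ F.1, γ ∈ S} := by
      have : {F : TightSpace C | ∃ γ ∈ F.1, γ ∈ S} =
          ⋃ γ ∈ S, {F : TightSpace C | γ ∈ F.1} := by
        ext F
        simp [and_comm]
      rw [this]
      exact isOpen_biUnion fun γ _ => isOpen_setOf_mem γ
    have huniv := (h _ hopen ?_).resolve_left ?_
    · exact exists_FE_subset hfa (fun F hF =>
        (Set.eq_univ_iff_forall.1 huniv ⟨F, hF⟩ : ∃ γ ∈ F, γ ∈ S)) α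
    -- Invariance: moving to an extension `η` of `γ` in the domain only precomposes `f`, and
    -- elements of the semigroup preserve sources.
    · rintro F G p ⟨γ, hγ, ⟨f⟩⟩
      obtain ⟨x, hx, y, hxy⟩ := p.meets
      obtain ⟨η, hη, h₁, ε, rfl⟩ := F.2.1.2.2 x hx γ hγ
      obtain ⟨δ, hδ, -⟩ := p.mem.initial hxy h₁
      refine ⟨δ, p.translate_eq.subset (mem_translate hη hδ), ?_⟩
      obtain ⟨e, -⟩ := p.mem.equivariant hδ
      change Nonempty (C.Hom δ.src β.src)
      rw [← e]
      exact ⟨C.comp ε.2 f⟩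
    · obtain ⟨D, hD, hβ⟩ := exists_maximal_mem β
      exact Set.Nonempty.ne_empty
        ⟨⟨D, maximalSets_subset_tightSets hD⟩, β, hβ, ⟨C.id _⟩⟩
  · intro h U hU hinv
    refine U.eq_empty_or_nonempty.imp id fun hne => Set.eq_univ_of_forall fun G => ?_
    obtain ⟨β, hβ⟩ := exists_cylinder_subset hfa hU hne
    obtain ⟨α, hα⟩ := G.2.1.1
    obtain ⟨K, hK, hKβ⟩ := h α β
    obtain ⟨γ, hγK, hγ⟩ := exists_mem_of_mem_FE hfa G.2 hα hK
    obtain ⟨f⟩ := hKβ γ hγK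
    -- `t` sends `γε` to `βfε`. As `γ ∈ G`, the set `t · G` contains `βf`, hence `β`, and so it lies
    -- in `U`; the inverse germ brings it back to `G`.
    let t : Mor C ≃. Mor C := (sigma hC γ).trans (tau hC ⟨γ.src, β.tgt, C.comp f β.hom⟩)
    have ht : InS hC t := InS.mul (.tau _) (.sigma _)
    have hmem : (⟨γ.src, β.tgt, C.comp f β.hom⟩ : Mor C) ∈ t γ := by
      refine (PEquiv.mem_trans _ _ _ _).2 ⟨(Into.unit C γ.src).toMor,
        mem_sigma.2 ⟨Into.unit C γ.src, rfl, ?_⟩, mem_tau.2 ⟨Into.unit C γ.src, rfl, ?_⟩⟩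
      · simp only [Mor.mul]
        rw [C.id_comp]
      · simp only [Mor.mul]
        rw [C.id_comp]
    have hne' : (G.1 ∩ dom t).Nonempty := ⟨γ, hγ, _, hmem⟩
    let G' : TightSpace C := ⟨translate t G.1, translate_mem_tightSets hfa ht G.2 hne'⟩
    have hG' : G' ∈ U := hβ G' ⟨γ, hγ, _, hmem, ⟨⟨γ.src, f⟩, rfl⟩⟩
    exact hinv G' G (PreGerm.inv ⟨t, ht, hne', rfl⟩) hG'

end Minimal

/-! ### Zappa-Szép products -/

section ZappaSzep

variable {V : Type*} {C : Category V} {Q : Type*} [Group Q] {Γ : Submonoid Q}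
  {d : LengthFunction C Γ} {𝒢 : Groupoid V}

/-- The component `α` of a morphism `(α, g)` of a Zappa-Szép product. -/
def CategorySystem.fst (S : CategorySystem d 𝒢) (p : Mor S.zappaSzep) : Mor C :=
  Into.toMor (ZSHom.left p.hom)

/-- The morphism `(α, s(α))` of a Zappa-Szép product. -/
def CategorySystem.incl (S : CategorySystem d 𝒢) (α : Mor C) : Mor S.zappaSzep :=
  ⟨α.src, α.tgt, ⟨⟨α.src, α.hom⟩, 𝒢.id α.src⟩⟩

/-- The action of `g` is onto and `𝒢` has inverses, so the equation `(α, g)(β, h) = (αδ, k)` is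
solved by `β = g⁻¹ · δ` and `h = φ(g, β)⁻¹ k`. -/
theorem CategorySystem.initial_iff (S : CategorySystem d 𝒢) {p q : Mor S.zappaSzep} :
    Initial p q ↔ Initial (S.fst p) (S.fst q) := by
  constructor
  · rintro ⟨r, rfl⟩
    exact ⟨S.act p.hom.right r.2.left, rfl⟩
  · obtain ⟨x, y, α, g⟩ := p
    obtain ⟨x', y', η, k⟩ := q
    rintro ⟨δ, h⟩
    obtain ⟨β, rfl⟩ : ∃ β, S.act g β = δ := (S.map g).toEquiv.surjective δ
    simp only [CategorySystem.fst, Mor.mul, Into.toMor, Mor.mk.injEq] at h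
    obtain ⟨h₁, rfl, h₂⟩ := h
    obtain ⟨e, f⟩ := η
    dsimp only at h₁ h₂ k
    subst h₁
    obtain rfl := eq_of_heq h₂
    refine ⟨⟨x', ⟨β, 𝒢.comp k (𝒢.inv (S.cocycle g β))⟩⟩, ?_⟩
    change (⟨x', y, S.zsMul ⟨α, g⟩ ⟨β, 𝒢.comp k (𝒢.inv (S.cocycle g β))⟩⟩ : Mor S.zappaSzep) = _
    unfold CategorySystem.zsMul
    dsimp only
    rw [𝒢.assoc, 𝒢.inv_comp, 𝒢.comp_id]

theorem CategorySystem.meets_iff (S : CategorySystem d 𝒢) {p q : Mor S.zappaSzep} :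
    Meets p q ↔ Meets (S.fst p) (S.fst q) := by
  constructor
  · rintro ⟨r, h, h'⟩
    exact ⟨S.fst r, S.initial_iff.1 h, S.initial_iff.1 h'⟩
  · rintro ⟨γ, h, h'⟩
    exact ⟨S.incl γ, S.initial_iff.2 h, S.initial_iff.2 h'⟩

theorem CategorySystem.zappaSzep_finitelyAligned (S : CategorySystem d 𝒢)
    (hfa : FinitelyAligned C) : FinitelyAligned S.zappaSzep := by
  classical
  intro p q
  obtain ⟨Δ, hΔ⟩ := hfa (S.fst p) (S.fst q)
  refine ⟨Δ.image S.incl, Set.ext fun r => ?_⟩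
  have h : S.fst r ∈ ideal (S.fst p) ∩ ideal (S.fst q) ↔ S.fst r ∈ ⋃ γ ∈ Δ, ideal γ := by rw [hΔ]
  rw [Set.mem_iUnion₂] at h
  rw [Finset.set_biUnion_finset_image, Set.mem_iUnion₂]
  refine (and_congr S.initial_iff S.initial_iff).trans (h.trans ?_)
  exact exists_congr fun γ => exists_congr fun _ => (S.initial_iff (p := S.incl γ)).symm

theorem CategorySystem.image_fst_mem_FE [DecidableEq (Mor C)] (S : CategorySystem d 𝒢)
    {p : Mor S.zappaSzep} {F : Finset (Mor S.zappaSzep)} (hF : F ∈ FE p) :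
    F.image S.fst ∈ FE (S.fst p) := by
  refine ⟨fun β hβ => ?_, fun γ hγ => ?_⟩
  · obtain ⟨q, hq, rfl⟩ := Finset.mem_image.1 hβ
    exact hF.1 q hq
  · obtain ⟨q, hq, h⟩ := hF.2 (S.incl γ) (S.initial_iff.2 hγ)
    exact ⟨S.fst q, Finset.mem_image_of_mem _ hq, S.meets_iff.1 h⟩

theorem CategorySystem.image_incl_mem_FE (S : CategorySystem d 𝒢)
    [DecidableEq (Mor S.zappaSzep)]
    {p : Mor S.zappaSzep} {F : Finset (Mor C)} (hF : F ∈ FE (S.fst p)) :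
    F.image S.incl ∈ FE p := by
  refine ⟨fun β hβ => ?_, fun q hq => ?_⟩
  · obtain ⟨γ, hγ, rfl⟩ := Finset.mem_image.1 hβ
    exact hF.1 γ hγ
  · obtain ⟨γ, hγ, h⟩ := hF.2 (S.fst q) (S.initial_iff.1 hq)
    exact ⟨S.incl γ, Finset.mem_image_of_mem _ hγ, S.meets_iff.2 h⟩

/-- Exhaustive sets in the Zappa-Szép product correspond to exhaustive sets in `Λ`. -/
theorem CategorySystem.exists_FE_zappaSzep_iff (S : CategorySystem d 𝒢) :
    (∀ α β : Mor S.zappaSzep, ∃ F ∈ FE α, ∀ γ ∈ F,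
        Nonempty (S.zappaSzep.Hom γ.src β.src)) ↔
      ∀ α β : Mor C, ∃ F ∈ FE α, ∀ γ ∈ F, ∃ (y : V) (g : 𝒢.Hom γ.src y),
        Nonempty (C.Hom (S.act g (Into.unit C γ.src)).1 β.src) := by
  classical
  constructor
  · intro h α β
    obtain ⟨F, hF, hFβ⟩ := h (S.incl α) (S.incl β)
    refine ⟨F.image S.fst, S.image_fst_mem_FE hF, fun γ hγ => ?_⟩
    obtain ⟨q, hq, rfl⟩ := Finset.mem_image.1 hγ
    obtain ⟨f⟩ := hFβ q hq
    -- For `q = (γ, a)` and `f = (η, b)`, the groupoid element `b a⁻¹` carries `s(γ)` to `s(η)`, and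
    -- `η` is the required morphism of `Λ`.
    refine ⟨f.left.1, 𝒢.comp (𝒢.inv q.hom.right) f.right, ?_⟩
    rw [S.act_unit]
    exact ⟨f.left.2⟩
  · intro h p q
    -- Only the source of the second morphism matters, and `s(β, b) = s(b)` may differ from `s(β)`;
    -- the identity at that object is therefore used.
    obtain ⟨F, hF, hFq⟩ := h (S.fst p) (Into.unit C q.src).toMor
    refine ⟨F.image S.incl, S.image_incl_mem_FE hF, fun r hr => ?_⟩
    obtain ⟨γ, hγ, rfl⟩ := Finset.mem_image.1 hr
    obtain ⟨y, g, hf⟩ := hFq γ hγ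
    rw [S.act_unit] at hf
    obtain ⟨f⟩ := hf
    exact ⟨⟨⟨y, f⟩, g⟩⟩

end ZappaSzep

end LCSC

theorem mainTheorem7 {V : Type*} (Λ : CategoryTheory.Category V)
    (hΛ : LCSC.LeftCancellative Λ) (hfa : LCSC.FinitelyAligned Λ)
    {Q : Type*} [Group Q] (Γ : Submonoid Q) (hΓ : ∀ q ∈ Γ, q⁻¹ ∈ Γ → q = 1)
    (d : LCSC.LengthFunction Λ Γ) (𝒢 : CategoryTheory.Groupoid V)
    (S : LCSC.CategorySystem d 𝒢)
    (h : T2Space (LCSC.GTight (S.zappaSzep_leftCancellative hΛ)) ∨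
      LCSC.tightSets Λ = LCSC.maximalSets Λ) :
    List.TFAE [
      LCSC.IsMinimal (LCSC.tightGroupoid (S.zappaSzep_leftCancellative hΛ)),
      ∀ α β : LCSC.Mor S.zappaSzep, ∃ F ∈ LCSC.FE α, ∀ γ ∈ F,
        Nonempty (S.zappaSzep.Hom γ.src β.src),
      ∀ α β : LCSC.Mor Λ, ∃ F ∈ LCSC.FE α, ∀ γ ∈ F,
        ∃ (y : V) (g : 𝒢.Hom γ.src y),
          Nonempty (Λ.Hom (S.act g (LCSC.Into.unit Λ γ.src)).1 β.src)] := by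
  tfae_have 1 ↔ 2 := LCSC.isMinimal_iff_exists_FE _ (S.zappaSzep_finitelyAligned hfa)
  tfae_have 2 ↔ 3 := S.exists_FE_zappaSzep_iff
  tfae_finish
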